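/- Let $\mathcal X,\mathcal U,\mathcal Y$ be complex Hilbert spaces and let $\Sigma=(A,B,C,D)$ be the discrete-time linear system $x(n+1)=Ax(n)+Bu(n)$, $y(n)=Cx(n)+Du(n)$ with bounded linear operators $A:\mathcal X\to\mathcal X$, $B:\mathcal U\to\mathcal X$, $C:\mathcal X\to\mathcal Y$, $D:\mathcal U\to\mathcal Y$ and system matrix $M=\begin{bmatrix}A&B\\C&D\end{bmatrix}:\mathcal X\oplus\mathcal U\to\mathcal X\oplus\mathcal Y$ (Hilbert space direct sums). No minimality is assumed. A system is called contractive if its system matrix has norm at most $1$. A system $\Sigma'=(A',B',C',D')$ with Hilbert state space $\mathcal X'$ and the same $\mathcal U,\mathcal Y$ is *similar* to $\Sigma$ if there is a bounded, boundedly invertible linear $\Gamma:\mathcal X\to\mathcal X'$ with $A'=\Gamma A\Gamma^{-1}$, $B'=\Gamma B$, $C'=C\Gamma^{-1}$, $D'=D$. The system $\Sigma$ is *pseudo-similar* to $\Sigma'$ if $D=D'$ and there is an injective, closed linear operator $\Gamma$ from a dense subspace $\mathcal D(\Gamma)$ of $\mathcal X$ to $\mathcal X'$, with dense range, such that $A\mathcal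 D(\Gamma)\subset\mathcal D(\Gamma)$, $\Gamma A|_{\mathcal D(\Gamma)}=A'\Gamma$, $B\,\mathcal U\subset\mathcal D(\Gamma)$, $B'=\Gamma B$ and $C|_{\mathcal D(\Gamma)}=C'\Gamma$. (1) $\Sigma$ is similar to a contractive system if and only if there is a bounded selfadjoint operator $H$ on $\mathcal X$ that is strictly positive-definite (for some $\delta>0$, $\langle Hx,x\rangle\ge\delta\|x\|^2$ for all $x\in\mathcal X$) and satisfies the Kalman–Yakubovich–Popov (KYP) inequality $$M^*\begin{bmatrix}H&0\\0&I_{\mathcal Y}\end{bmatrix}M\preceq\begin{bmatrix}H&0\\0&I_{\mathcal U}\end{bmatrix}.$$ (2) $\Sigma$ is pseudo-similar to a contractive system if and only if there is a generalized positive-definite solution of the spatial KYP inequality, that is, a closed, densely defined, injective, selfadjoint, possibly unbounded operator $H$ on $\mathcal X$ with $\langle Hx,x\rangle>0$ for all nonzero $x\in\mathcal D(H)$ such that, with $H^{1/2}$ the nonnegative selfadjoint square root of $H$, $$A\,\mathcal D(H^{1/2})\subset\mathcal D(H^{1/2}),\qquad B\,\mathcal U\subset\mathcal D(H^{1/2}),$$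 $$\left\|\begin{bmatrix}H^{1/2}&0\\0&I_{\mathcal U}\end{bmatrix}\begin{bmatrix}x\\u\end{bmatrix}\right\|^2-\left\|\begin{bmatrix}H^{1/2}&0\\0&I_{\mathcal Y}\end{bmatrix}\begin{bmatrix}A&B\\C&D\end{bmatrix}\begin{bmatrix}x\\u\end{bmatrix}\right\|^2\ge0\qquad(x\in\mathcal D(H^{1/2}),\ u\in\mathcal U).$$ -/

import Mathlib

open scoped InnerProductSpace

universe u v w

noncomputable section

/-- The discrete-time linear system `x(n+1) = A x(n) + B u(n)`, `y(n) = C x(n) + D u(n)` with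
state space `X`, input space `U`, output space `Y` and bounded coefficients. -/
structure DTSystem (X U Y : Type*)
    [NormedAddCommGroup X] [InnerProductSpace ℂ X]
    [NormedAddCommGroup U] [InnerProductSpace ℂ U]
    [NormedAddCommGroup Y] [InnerProductSpace ℂ Y] where
  A : X →L[ℂ] X
  B : U →L[ℂ] X
  C : X →L[ℂ] Y
  D : U →L[ℂ] Y

/-- The block operator `[A B; C D]` between Hilbert space direct sums. -/
def blockOp {X U X' Y : Type*}
    [NormedAddCommGroup X] [InnerProductSpace ℂ X]
    [NormedAddCommGroup U] [InnerProductSpace ℂ U]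
    [NormedAddCommGroup X'] [InnerProductSpace ℂ X']
    [NormedAddCommGroup Y] [InnerProductSpace ℂ Y]
    (A : X →L[ℂ] X') (B : U →L[ℂ] X') (C : X →L[ℂ] Y) (D : U →L[ℂ] Y) :
    WithLp 2 (X × U) →L[ℂ] WithLp 2 (X' × Y) :=
  (WithLp.prodContinuousLinearEquiv 2 ℂ X' Y).symm.toContinuousLinearMap ∘L
    ((A.coprod B).prod (C.coprod D)) ∘L
      (WithLp.prodContinuousLinearEquiv 2 ℂ X U).toContinuousLinearMap

namespace LinearPMap

variable {X : Type*} [NormedAddCommGroup X] [InnerProductSpace ℂ X] [CompleteSpace X]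

/-- `S` is a nonnegative selfadjoint (possibly unbounded) operator with `S ∘ S = H`, where
`S ∘ S` has its natural domain `{x ∈ D(S) | S x ∈ D(S)}`. -/
structure IsPosSqrt (S H : X →ₗ.[ℂ] X) : Prop where
  isSelfAdjoint : IsSelfAdjoint S
  nonneg : ∀ x : S.domain, 0 ≤ (⟪S x, (x : X)⟫_ℂ).re
  sq : ∀ x y : X, (x, y) ∈ H.graph ↔ ∃ z : X, (x, z) ∈ S.graph ∧ (z, y) ∈ S.graph

/-- `H^{1/2}`: the nonnegative selfadjoint square root of `H`, which exists and is unique if `H` is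
selfadjoint and positive-semidefinite (for other `H` the value is irrelevant). -/
def posSqrt (H : X →ₗ.[ℂ] X) : X →ₗ.[ℂ] X :=
  Classical.epsilon fun S : X →ₗ.[ℂ] X => S.IsPosSqrt H

end LinearPMap

namespace DTSystem

variable {X X' U Y : Type*}
  [NormedAddCommGroup X] [InnerProductSpace ℂ X] [CompleteSpace X]
  [NormedAddCommGroup X'] [InnerProductSpace ℂ X'] [CompleteSpace X']
  [NormedAddCommGroup U] [InnerProductSpace ℂ U] [CompleteSpace U]
  [NormedAddCommGroup Y] [InnerProductSpace ℂ Y] [CompleteSpace Y]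

/-- The system matrix `M = [A B; C D] : X ⊕ U → X ⊕ Y`. -/
def systemMatrix (S : DTSystem X U Y) : WithLp 2 (X × U) →L[ℂ] WithLp 2 (X × Y) :=
  blockOp S.A S.B S.C S.D

/-- The system matrix is a contraction between the Hilbert space direct sums. -/
def IsContractive (S : DTSystem X U Y) : Prop := ‖S.systemMatrix‖ ≤ 1

/-- Similarity: `[A' B'; C' D'] = [Γ A Γ⁻¹, Γ B; C Γ⁻¹, D]` for a bounded and boundedly
invertible `Γ : X → X'`. -/
def Similar (S : DTSystem X U Y) (S' : DTSystem X' U Y) : Prop :=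
  ∃ Γ : X ≃L[ℂ] X',
    S'.A = Γ.toContinuousLinearMap ∘L S.A ∘L Γ.symm.toContinuousLinearMap ∧
    S'.B = Γ.toContinuousLinearMap ∘L S.B ∧
    S'.C = S.C ∘L Γ.symm.toContinuousLinearMap ∧
    S'.D = S.D

/-- `Γ` is a pseudo-similarity from `S` to `S'`. -/
structure IsPseudoSimilarity (S : DTSystem X U Y) (S' : DTSystem X' U Y)
    (Γ : X →ₗ.[ℂ] X') : Prop where
  injective : Function.Injective Γ
  isClosed : Γ.IsClosed
  dense_domain : Dense (Γ.domain : Set X)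
  dense_range : Dense (Set.range Γ)
  mapsTo_A : ∀ x ∈ Γ.domain, S.A x ∈ Γ.domain
  intertwine_A : ∀ x : Γ.domain, Γ ⟨S.A x, mapsTo_A x x.2⟩ = S'.A (Γ x)
  mapsTo_B : ∀ u : U, S.B u ∈ Γ.domain
  intertwine_B : ∀ u : U, S'.B u = Γ ⟨S.B u, mapsTo_B u⟩
  intertwine_C : ∀ x : Γ.domain, S.C x = S'.C (Γ x)

def PseudoSimilar (S : DTSystem X U Y) (S' : DTSystem X' U Y) : Prop :=
  S.D = S'.D ∧ ∃ Γ : X →ₗ.[ℂ] X', S.IsPseudoSimilarity S' Γ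

/-- The bounded operator `H` solves the KYP inequality
`M* [H 0; 0 I] M ≼ [H 0; 0 I]` (Loewner order). -/
def KYPInequality (S : DTSystem X U Y) (H : X →L[ℂ] X) : Prop :=
  ContinuousLinearMap.adjoint S.systemMatrix ∘L
      blockOp H 0 0 (ContinuousLinearMap.id ℂ Y) ∘L S.systemMatrix
    ≤ blockOp H 0 0 (ContinuousLinearMap.id ℂ U)

/-- `H` is bounded, selfadjoint and `⟪H x, x⟫ ≥ δ ‖x‖²` for some `δ > 0`. -/
def IsStrictlyPosDef (H : X →L[ℂ] X) : Prop :=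
  IsSelfAdjoint H ∧ ∃ δ : ℝ, 0 < δ ∧ ∀ x : X, δ * ‖x‖ ^ 2 ≤ (⟪H x, x⟫_ℂ).re

/-- The possibly unbounded operator `H` is a generalized positive-definite solution of the spatial
KYP inequality. -/
structure IsGeneralizedKYPSolution (S : DTSystem X U Y) (H : X →ₗ.[ℂ] X) : Prop where
  isClosed : H.IsClosed
  dense_domain : Dense (H.domain : Set X)
  injective : Function.Injective H
  isSelfAdjoint : IsSelfAdjoint H
  pos : ∀ x : H.domain, x ≠ 0 → 0 < (⟪H x, (x : X)⟫_ℂ).re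
  mapsTo_A : ∀ x ∈ H.posSqrt.domain, S.A x ∈ H.posSqrt.domain
  mapsTo_B : ∀ u : U, S.B u ∈ H.posSqrt.domain
  spatial : ∀ (x : H.posSqrt.domain) (u : U),
    0 ≤ ‖WithLp.toLp 2 (H.posSqrt x, u)‖ ^ 2 -
      ‖WithLp.toLp 2
        (H.posSqrt ⟨S.A x + S.B u, H.posSqrt.domain.add_mem (mapsTo_A x x.2) (mapsTo_B u)⟩,
          S.C x + S.D u)‖ ^ 2

end DTSystem

end

/-! In both parts `H` and `Γ` determine each other through `H = Γ*Γ` and `Γ = H^{1/2}`. With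
`‖H^{1/2} x‖ = ‖Γ x‖`, either KYP inequality reads `‖Γ(Ax + Bu)‖² + ‖Cx + Du‖² ≤ ‖Γx‖² + ‖u‖²`,
which is contractivity of the transformed system on the range of `Γ` times the input space. For
bounded `Γ` the square root comes from the continuous functional calculus.

For closed `Γ` everything passes through the bounded operator `R = (1 + Γ*Γ)⁻¹ = j j*`, where `j` is
the first projection on the graph of `Γ`. It encodes `H` by `y = Hx ↔ R(x + y) = x`, and `H^{1/2}`
has graph `{(R^{1/2} z, (1 - R)^{1/2} z)}` (`exists_isPosSqrt_of_resolvent`). Closed operators with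
the same `R` have equal domains and norms (`exists_mem_graph_of_resolvent_eq`), so `H^{1/2}` can
replace `Γ`. Conversely, the spatial inequality makes the transformed system matrix contractive on a
dense subspace; its extension is the required system, again with state space `X`. -/

namespace LinearPMap

/-! ### Graphs as subspaces of the Hilbert space direct sum. -/

section Graph

variable {X X' : Type*}
  [NormedAddCommGroup X] [InnerProductSpace ℂ X]
  [NormedAddCommGroup X'] [InnerProductSpace ℂ X']

theorem mem_graph_adjoint_iff [CompleteSpace X] {T : X →ₗ.[ℂ] X'} (hT : Dense (T.domain : Set X))
    {x : X'} {y : X} :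
    (x, y) ∈ T.adjoint.graph ↔ ∀ a b, (a, b) ∈ T.graph → ⟪b, x⟫_ℂ = ⟪a, y⟫_ℂ := by
  rw [adjoint_graph_eq_graph_adjoint hT, Submodule.mem_adjoint_iff]
  simp only [sub_eq_zero]

theorem mem_graph_iff_of_isSelfAdjoint [CompleteSpace X] {T : X →ₗ.[ℂ] X} (hT : IsSelfAdjoint T)
    {x y : X} : (x, y) ∈ T.graph ↔ ∀ a b, (a, b) ∈ T.graph → ⟪b, x⟫_ℂ = ⟪a, y⟫_ℂ := by
  conv_lhs => rw [← isSelfAdjoint_def.1 hT]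
  exact mem_graph_adjoint_iff hT.dense_domain

theorem nonneg_of_mem_graph {T : X →ₗ.[ℂ] X} (hT : ∀ x : T.domain, 0 ≤ (⟪T x, (x : X)⟫_ℂ).re)
    {x y : X} (h : (x, y) ∈ T.graph) : 0 ≤ (⟪y, x⟫_ℂ).re := by
  obtain ⟨z, rfl, rfl⟩ := (mem_graph_iff T).1 h
  exact hT z

/-- The graph of a linear operator, as a subspace of the Hilbert space direct sum. -/
def l2Graph (T : X →ₗ.[ℂ] X') : Submodule ℂ (WithLp 2 (X × X')) :=
  T.graph.comap (WithLp.linearEquiv 2 ℂ (X × X')).toLinearMap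

theorem mem_l2Graph {T : X →ₗ.[ℂ] X'} {p : WithLp 2 (X × X')} :
    p ∈ T.l2Graph ↔ (p.fst, p.snd) ∈ T.graph := Iff.rfl

theorem IsClosed.isClosed_l2Graph {T : X →ₗ.[ℂ] X'} (hT : T.IsClosed) :
    _root_.IsClosed (T.l2Graph : Set (WithLp 2 (X × X'))) :=
  hT.preimage (WithLp.prodContinuousLinearEquiv 2 ℂ X X').continuous

/-- The first coordinate projection on the graph. -/
def graphFst (T : X →ₗ.[ℂ] X') : T.l2Graph →L[ℂ] X :=
  (ContinuousLinearMap.fst ℂ X X' ∘L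
    (WithLp.prodContinuousLinearEquiv 2 ℂ X X').toContinuousLinearMap) ∘L T.l2Graph.subtypeL

@[simp]
theorem graphFst_apply (T : X →ₗ.[ℂ] X') (p : T.l2Graph) :
    T.graphFst p = (p : WithLp 2 (X × X')).fst := rfl

theorem norm_graphFst_le (T : X →ₗ.[ℂ] X') (p : T.l2Graph) : ‖T.graphFst p‖ ≤ ‖p‖ := by
  have h := WithLp.prod_norm_sq_eq_of_L2 (p : WithLp 2 (X × X'))
  rw [graphFst_apply, ← Submodule.norm_coe]
  nlinarith [norm_nonneg (p : WithLp 2 (X × X')), norm_nonneg (p : WithLp 2 (X × X')).fst,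
    sq_nonneg ‖(p : WithLp 2 (X × X')).snd‖]

theorem graphFst_injective (T : X →ₗ.[ℂ] X') : Function.Injective T.graphFst := by
  refine (injective_iff_map_eq_zero _).2 fun p hp => ?_
  have hp' : (p : WithLp 2 (X × X')).fst = 0 := hp
  have h0 := graph_fst_eq_zero_snd T (mem_l2Graph.1 p.2) hp'
  have h := WithLp.prod_norm_sq_eq_of_L2 (p : WithLp 2 (X × X'))
  rw [hp', h0] at h
  simpa using h

end Graph

/-! ### Selfadjoint operators and square roots via bounded resolvents. -/

section Resolvent

open ContinuousLinearMap

variable {X X₁ X₂ : Type*}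
  [NormedAddCommGroup X] [InnerProductSpace ℂ X] [CompleteSpace X]
  [NormedAddCommGroup X₁] [InnerProductSpace ℂ X₁]
  [NormedAddCommGroup X₂] [InnerProductSpace ℂ X₂]

theorem denseRange_adjoint_graphFst (T : X →ₗ.[ℂ] X₁) [CompleteSpace T.l2Graph] :
    DenseRange (ContinuousLinearMap.adjoint T.graphFst) := by
  have h := ContinuousLinearMap.orthogonal_range (ContinuousLinearMap.adjoint T.graphFst)
  rw [ContinuousLinearMap.adjoint_adjoint, LinearMap.ker_eq_bot.2 T.graphFst_injective] at h
  have := (Submodule.dense_iff_topologicalClosure_eq_top).2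
    ((Submodule.topologicalClosure_eq_top_iff).2 h)
  rw [LinearMap.coe_range] at this
  exact this

/-- Two closed operators `T₁`, `T₂` with `(1 + T₁* T₁)⁻¹ = (1 + T₂* T₂)⁻¹` are metrically equal. -/
theorem exists_mem_graph_of_resolvent_eq {T₁ : X →ₗ.[ℂ] X₁} {T₂ : X →ₗ.[ℂ] X₂}
    [CompleteSpace T₁.l2Graph] [CompleteSpace T₂.l2Graph]
    (h : T₁.graphFst ∘L ContinuousLinearMap.adjoint T₁.graphFst =
      T₂.graphFst ∘L ContinuousLinearMap.adjoint T₂.graphFst)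
    {x : X} {y₁ : X₁} (hx : (x, y₁) ∈ T₁.graph) :
    ∃ y₂, (x, y₂) ∈ T₂.graph ∧ ‖y₂‖ = ‖y₁‖ := by
  set j₁ := T₁.graphFst
  set j₂ := T₂.graphFst
  have hnorm (v : X) : ‖ContinuousLinearMap.adjoint j₂ v‖ = ‖ContinuousLinearMap.adjoint j₁ v‖ := by
    have key : (⟪ContinuousLinearMap.adjoint j₂ v, ContinuousLinearMap.adjoint j₂ v⟫_ℂ) =
        ⟪ContinuousLinearMap.adjoint j₁ v, ContinuousLinearMap.adjoint j₁ v⟫_ℂ := by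
      rw [adjoint_inner_right, adjoint_inner_right]
      exact congrArg (fun R : X →L[ℂ] X => ⟪R v, v⟫_ℂ) h.symm
    have key' : ‖ContinuousLinearMap.adjoint j₂ v‖ ^ 2 =
        ‖ContinuousLinearMap.adjoint j₁ v‖ ^ 2 := by
      rw [← inner_self_eq_norm_sq (𝕜 := ℂ), ← inner_self_eq_norm_sq (𝕜 := ℂ), key]
    exact (sq_eq_sq₀ (norm_nonneg _) (norm_nonneg _)).1 key'
  have hd := T₁.denseRange_adjoint_graphFst
  have hb : ∃ C, ∀ v, ‖(ContinuousLinearMap.adjoint j₂ : X →ₗ[ℂ] T₂.l2Graph) v‖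
      ≤ C * ‖(ContinuousLinearMap.adjoint j₁ : X →ₗ[ℂ] T₁.l2Graph) v‖ :=
    ⟨1, fun v => by simp [hnorm]⟩
  -- The map `j₁* v ↦ j₂* v` is isometric with dense domain; its extension `V` satisfies `j₂ V =
  -- j₁`, so it preserves first coordinates and graph norms, hence norms of second coordinates.
  let V : T₁.l2Graph →L[ℂ] T₂.l2Graph :=
    (ContinuousLinearMap.adjoint j₂ : X →ₗ[ℂ] T₂.l2Graph).extendOfNorm
      (ContinuousLinearMap.adjoint j₁ : X →ₗ[ℂ] T₁.l2Graph)
  have hV (v : X) : V (ContinuousLinearMap.adjoint j₁ v) = ContinuousLinearMap.adjoint j₂ v :=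
    LinearMap.extendOfNorm_eq hd hb v
  have hVn : (fun p => ‖V p‖) = fun p => ‖p‖ :=
    hd.equalizer (by fun_prop) (by fun_prop) (funext fun v =>
      (congrArg norm (hV v)).trans (hnorm v))
  have hVj : (fun p => j₂ (V p)) = fun p => j₁ p :=
    hd.equalizer (by fun_prop) (by fun_prop) (funext fun v =>
      (congrArg j₂ (hV v)).trans (congrArg (fun R : X →L[ℂ] X => R v) h.symm))
  let p : T₁.l2Graph := ⟨WithLp.toLp 2 (x, y₁), hx⟩
  have h1 : ((V p : T₂.l2Graph) : WithLp 2 (X × X₂)).fst = x := congrFun hVj p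
  have h2 : ‖(V p : WithLp 2 (X × X₂))‖ = ‖(p : WithLp 2 (X × X₁))‖ := congrFun hVn p
  refine ⟨(V p : WithLp 2 (X × X₂)).snd, ?_, ?_⟩
  · simpa only [h1] using mem_l2Graph.1 (V p).2
  · have e1 := WithLp.prod_norm_sq_eq_of_L2 (V p : WithLp 2 (X × X₂))
    have e2 := WithLp.prod_norm_sq_eq_of_L2 (p : WithLp 2 (X × X₁))
    have e3 : (p : WithLp 2 (X × X₁)).fst = x := rfl
    have e4 : (p : WithLp 2 (X × X₁)).snd = y₁ := rfl
    rw [h1, h2, e2, e3, e4] at e1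
    exact (sq_eq_sq₀ (norm_nonneg _) (norm_nonneg _)).1 (by linarith)

/-- An operator whose graph is parametrized by commuting bounded selfadjoint operators `P`, `Q`. -/
theorem exists_isSelfAdjoint_graph_eq {P Q a b : X →L[ℂ] X} (hP : IsSelfAdjoint P)
    (hQ : IsSelfAdjoint Q) (hPi : Function.Injective P) (hPQ : Commute P Q) (haP : Commute P a)
    (hbP : Commute P b) (haQ : Commute Q a) (hbQ : Commute Q b) (hab : a * P + b * Q = 1) :
    ∃ T : X →ₗ.[ℂ] X, IsSelfAdjoint T ∧
      ∀ x y, (x, y) ∈ T.graph ↔ ∃ z, P z = x ∧ Q z = y := by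
  let g : Submodule ℂ (X × X) := LinearMap.range ((P : X →ₗ[ℂ] X).prod (Q : X →ₗ[ℂ] X))
  have hg : ∀ p ∈ g, p.1 = 0 → p.2 = 0 := by
    rintro _ ⟨z, rfl⟩ hz
    have : z = 0 := hPi (by simpa using hz)
    simp [this]
  have hT (x y : X) : (x, y) ∈ g.toLinearPMap.graph ↔ ∃ z, P z = x ∧ Q z = y := by
    rw [Submodule.toLinearPMap_graph_eq g hg]
    simp [g, Prod.ext_iff]
  have hdense : Dense (g.toLinearPMap.domain : Set X) := by
    have h := ContinuousLinearMap.orthogonal_range P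
    rw [hP.adjoint_eq, LinearMap.ker_eq_bot.2 hPi] at h
    have := (Submodule.dense_iff_topologicalClosure_eq_top).2
      ((Submodule.topologicalClosure_eq_top_iff).2 h)
    refine this.mono ?_
    rintro _ ⟨z, rfl⟩
    exact mem_domain_of_mem_graph ((hT _ _).2 ⟨z, rfl, rfl⟩)
  refine ⟨g.toLinearPMap, isSelfAdjoint_def.2 (eq_of_eq_graph ?_), hT⟩
  have comm {K L : X →L[ℂ] X} (h : Commute K L) (z : X) : K (L z) = L (K z) :=
    congrArg (fun R : X →L[ℂ] X => R z) h.eq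
  ext ⟨x, y⟩
  rw [mem_graph_adjoint_iff hdense, hT]
  constructor
  · intro h
    have hxy : Q x = P y := by
      refine ext_inner_left ℂ fun z => ?_
      have := h _ _ ((hT _ _).2 ⟨z, rfl, rfl⟩)
      rwa [← adjoint_inner_right, ← adjoint_inner_right, hP.adjoint_eq, hQ.adjoint_eq] at this
    have hid (z : X) : a (P z) + b (Q z) = z := congrArg (fun R : X →L[ℂ] X => R z) hab
    -- Membership in the adjoint graph amounts to `Qx = Py`; with `aP + bQ = 1` and commutation this
    -- recovers the parameter of `(x, y)`.
    refine ⟨a x + b y, ?_, ?_⟩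
    · rw [_root_.map_add, comm haP, comm hbP, ← hxy, hid]
    · rw [_root_.map_add, comm haQ, comm hbQ, hxy, hid]
  · rintro ⟨z, rfl, rfl⟩ c d hcd
    obtain ⟨t, rfl, rfl⟩ := (hT _ _).1 hcd
    rw [← adjoint_inner_right, ← adjoint_inner_right, hP.adjoint_eq, hQ.adjoint_eq, comm hPQ]

theorem exists_isSelfAdjoint_of_resolvent {R : X →L[ℂ] X} (hR : IsSelfAdjoint R)
    (hRi : Function.Injective R) :
    ∃ H : X →ₗ.[ℂ] X, IsSelfAdjoint H ∧ ∀ x y, (x, y) ∈ H.graph ↔ R (x + y) = x := by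
  obtain ⟨H, hH, hg⟩ := exists_isSelfAdjoint_graph_eq hR ((IsSelfAdjoint.one _).sub hR) hRi
    ((Commute.one_right R).sub_right (Commute.refl R)) (Commute.one_right R)
    (Commute.one_right R) (Commute.one_right _) (Commute.one_right _) (by simp)
  refine ⟨H, hH, fun x y => (hg x y).trans ⟨?_, fun h => ⟨x + y, h, by simp [h]⟩⟩⟩
  rintro ⟨z, rfl, rfl⟩
  simp

/-- With `P = R^{1/2}` and `Q = (1 - R)^{1/2}`, the identity `P² + Q² = 1` makes `{(Pz, Qz)}`
selfadjoint. It is nonnegative because `PQ`, a product of commuting nonnegative operators, is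
nonnegative. -/
theorem exists_isPosSqrt_of_resolvent {R : X →L[ℂ] X} (hR : 0 ≤ R) (hR1 : R ≤ 1)
    {H : X →ₗ.[ℂ] X} (hH : ∀ x y, (x, y) ∈ H.graph ↔ R (x + y) = x) :
    ∃ S : X →ₗ.[ℂ] X, S.IsPosSqrt H := by
  have hQ0 : 0 ≤ 1 - R := sub_nonneg.2 hR1
  have hRi : Function.Injective R := by
    refine (injective_iff_map_eq_zero _).2 fun v hv => ?_
    exact graph_fst_eq_zero_snd H ((hH 0 v).2 (by simpa using hv)) rfl
  set P := CFC.sqrt R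
  set Q := CFC.sqrt (1 - R)
  have hPP : P * P = R := CFC.sqrt_mul_sqrt_self R hR
  have hQQ : Q * Q = 1 - R := CFC.sqrt_mul_sqrt_self _ hQ0
  have hP : 0 ≤ P := CFC.sqrt_nonneg R
  have hQ : 0 ≤ Q := CFC.sqrt_nonneg _
  have hPR : Commute P (1 - R) := by
    rw [← hPP]
    exact (Commute.one_right P).sub_right ((Commute.refl P).mul_right (Commute.refl P))
  have hPQ : Commute P Q := (hPR.symm.cfcₙ_nnreal _).symm
  have hPi : Function.Injective P := by
    intro x y hxy
    apply hRi
    rw [← hPP]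
    exact congrArg P hxy
  obtain ⟨S, hS, hg⟩ := exists_isSelfAdjoint_graph_eq (IsSelfAdjoint.of_nonneg hP)
    (IsSelfAdjoint.of_nonneg hQ) hPi hPQ (Commute.refl P) hPQ hPQ.symm (Commute.refl Q)
    (by rw [hPP, hQQ, add_sub_cancel])
  have hPP' (z : X) : P (P z) = R z := congrArg (fun K : X →L[ℂ] X => K z) hPP
  have hQQ' (z : X) : Q (Q z) = z - R z := congrArg (fun K : X →L[ℂ] X => K z) hQQ
  have hPQ' (z : X) : P (Q z) = Q (P z) := congrArg (fun K : X →L[ℂ] X => K z) hPQ.eq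
  refine ⟨S, hS, fun x => ?_, fun x y => ?_⟩
  · obtain ⟨z, hz, hz'⟩ := (hg _ _).1 (S.mem_graph x)
    rw [← hz, ← hz', ← adjoint_inner_left, (IsSelfAdjoint.of_nonneg hP).adjoint_eq]
    have : 0 ≤ P * Q := hPQ.mul_nonneg hP hQ
    exact ((nonneg_iff_isPositive _).1 this).re_inner_nonneg_left z
  · rw [hH]
    constructor
    · intro h
      refine ⟨P (Q (x + y)), (hg _ _).2 ⟨P (x + y), by rw [hPP', h], (hPQ' _).symm⟩,
        (hg _ _).2 ⟨Q (x + y), rfl, ?_⟩⟩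
      rw [hQQ', h, add_sub_cancel_left]
    · rintro ⟨z, h1, h2⟩
      obtain ⟨s, rfl, rfl⟩ := (hg _ _).1 h1
      obtain ⟨t, ht, rfl⟩ := (hg _ _).1 h2
      -- Here `x = Ps`, `Qs = Pt` and `y = Qt`, so `P(Ps + Qt) = P²s + Q²s = s`.
      have hs : P (P s + Q t) = s := by
        rw [_root_.map_add, hPP', hPQ', ht, hQQ', add_sub_cancel]
      rw [← hPP', hs]

theorem isPosSqrt_posSqrt {H : X →ₗ.[ℂ] X} (h : ∃ S : X →ₗ.[ℂ] X, S.IsPosSqrt H) :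
    H.posSqrt.IsPosSqrt H :=
  Classical.epsilon_spec h

/-- Nonnegativity gives `‖x + Hx‖² ≥ ‖x‖² + ‖Hx‖²`, so `1 + H` has closed range; selfadjointness
makes the range dense. `R` is the inverse of `1 + H`. -/
theorem exists_resolvent_of_isSelfAdjoint {H : X →ₗ.[ℂ] X} (hH : IsSelfAdjoint H)
    (hpos : ∀ x : H.domain, 0 ≤ (⟪H x, (x : X)⟫_ℂ).re) :
    ∃ R : X →L[ℂ] X, 0 ≤ R ∧ R ≤ 1 ∧ ∀ x y, (x, y) ∈ H.graph ↔ R (x + y) = x := by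
  have : CompleteSpace H.l2Graph := hH.isClosed.isClosed_l2Graph.completeSpace_coe
  let σ : H.l2Graph →L[ℂ] X :=
    ((ContinuousLinearMap.fst ℂ X X + ContinuousLinearMap.snd ℂ X X) ∘L
      (WithLp.prodContinuousLinearEquiv 2 ℂ X X).toContinuousLinearMap) ∘L H.l2Graph.subtypeL
  have hσ (p : H.l2Graph) : σ p = (p : WithLp 2 (X × X)).fst + (p : WithLp 2 (X × X)).snd := rfl
  have hle (p : H.l2Graph) : ‖p‖ ≤ ‖σ p‖ := by
    have h1 := WithLp.prod_norm_sq_eq_of_L2 (p : WithLp 2 (X × X))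
    have h2 := norm_add_sq (𝕜 := ℂ) (p : WithLp 2 (X × X)).snd (p : WithLp 2 (X × X)).fst
    have h3 := nonneg_of_mem_graph hpos (mem_l2Graph.1 p.2)
    rw [add_comm, ← hσ] at h2
    simp only [RCLike.re_to_complex] at h2
    rw [← sq_le_sq₀ (norm_nonneg _) (norm_nonneg _), ← Submodule.norm_coe]
    linarith
  have hanti : AntilipschitzWith 1 σ :=
    AddMonoidHomClass.antilipschitz_of_bound σ fun p => by simpa using hle p
  have hclosed : _root_.IsClosed (LinearMap.range (σ : H.l2Graph →ₗ[ℂ] X) : Set X) := by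
    rw [LinearMap.coe_range]
    exact hanti.isClosed_range σ.uniformContinuous
  have horth : (LinearMap.range (σ : H.l2Graph →ₗ[ℂ] X))ᗮ = ⊥ := by
    refine (Submodule.eq_bot_iff _).2 fun w hw => ?_
    -- A vector `w` orthogonal to the range of `1 + H` satisfies `Hw = -w`, whence `-‖w‖² ≥ 0`.
    have hw' : (w, -w) ∈ H.graph := by
      refine (mem_graph_iff_of_isSelfAdjoint hH).2 fun a b hab => ?_
      have := (Submodule.mem_orthogonal _ _).1 hw _ ⟨⟨WithLp.toLp 2 (a, b), hab⟩, rfl⟩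
      have e : ⟪a + b, w⟫_ℂ = 0 := this
      rw [inner_add_left] at e
      rw [inner_neg_right]
      exact eq_neg_of_add_eq_zero_right e
    have h0 := nonneg_of_mem_graph hpos hw'
    have h1 : ⟪w, w⟫_ℂ = (‖w‖ ^ 2 : ℝ) := by rw [inner_self_eq_norm_sq_to_K]; norm_cast
    rw [inner_neg_left, h1, Complex.neg_re, Complex.ofReal_re] at h0
    exact norm_eq_zero.1 (pow_eq_zero_iff two_ne_zero |>.1
      (le_antisymm (by linarith) (sq_nonneg _)))
  have hsurj : Function.Surjective σ := by
    have h := (Submodule.topologicalClosure_eq_top_iff).2 horth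
    rw [hclosed.submodule_topologicalClosure_eq] at h
    exact LinearMap.range_eq_top.1 h
  let e := LinearEquiv.ofBijective (σ : H.l2Graph →ₗ[ℂ] X) ⟨hanti.injective, hsurj⟩
  have he (v : X) : σ (e.symm v) = v := e.apply_symm_apply v
  have hes (p : H.l2Graph) : e.symm (σ p) = p := e.symm_apply_apply p
  let R : X →L[ℂ] X := LinearMap.mkContinuous
    ((H.graphFst : H.l2Graph →ₗ[ℂ] X) ∘ₗ (e.symm : X →ₗ[ℂ] H.l2Graph)) 1 fun v => by
      rw [one_mul]
      refine (H.norm_graphFst_le _).trans ((hle _).trans_eq ?_)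
      exact congrArg norm (he v)
  have hR (v : X) : R v = ((e.symm v : H.l2Graph) : WithLp 2 (X × X)).fst := rfl
  have hRm (v : X) : (R v, v - R v) ∈ H.graph := by
    have h1 := mem_l2Graph.1 (e.symm v).2
    have h2 : v - R v = ((e.symm v : H.l2Graph) : WithLp 2 (X × X)).snd := by
      rw [sub_eq_iff_eq_add, hR, add_comm, ← hσ, he]
    rwa [h2, hR]
  have hRH (x y : X) : (x, y) ∈ H.graph ↔ R (x + y) = x := by
    constructor
    · intro h
      have := hes ⟨WithLp.toLp 2 (x, y), h⟩
      have h2 : e.symm (x + y) = ⟨WithLp.toLp 2 (x, y), h⟩ := this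
      exact (hR _).trans (congrArg (fun p : H.l2Graph => (p : WithLp 2 (X × X)).fst) h2)
    · intro h
      have := hRm (x + y)
      rwa [h, add_sub_cancel_left] at this
  have hnn (v : X) : 0 ≤ (⟪v - R v, R v⟫_ℂ).re := nonneg_of_mem_graph hpos (hRm v)
  have hsym : IsSelfAdjoint R := by
    rw [isSelfAdjoint_iff_isSymmetric]
    intro v w
    have h := (mem_graph_iff_of_isSelfAdjoint hH).1 (hRm w) _ _ (hRm v)
    rw [inner_sub_left, inner_sub_right] at h
    have := sub_left_injective h
    exact this.symm
  have hself (x : X) : (⟪x, x⟫_ℂ).re = ‖x‖ ^ 2 := inner_self_eq_norm_sq (𝕜 := ℂ) x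
  refine ⟨R, (nonneg_iff_isPositive _).2 (isPositive_def'.2 ⟨hsym, fun v => ?_⟩),
    sub_nonneg.1 <| (nonneg_iff_isPositive _).2 (isPositive_def'.2
      ⟨(IsSelfAdjoint.one _).sub hsym, fun v => ?_⟩), hRH⟩
  · change 0 ≤ (⟪R v, v⟫_ℂ).re
    have h := hnn v
    have e : ⟪v, R v⟫_ℂ = ⟪R v, v⟫_ℂ := (hsym.isSymmetric v v).symm
    rw [inner_sub_left, Complex.sub_re, hself, e] at h
    nlinarith [sq_nonneg ‖R v‖]
  · change 0 ≤ (⟪v - R v, v⟫_ℂ).re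
    have h : ⟪v - R v, v⟫_ℂ = ⟪v - R v, v - R v⟫_ℂ + ⟪v - R v, R v⟫_ℂ := by
      rw [← inner_add_right, sub_add_cancel]
    rw [h, Complex.add_re, hself]
    exact add_nonneg (sq_nonneg _) (hnn v)

/-! ### The operator `j j* = (1 + T*T)⁻¹` of a closed operator `T`. -/

variable (T : X →ₗ.[ℂ] X₁) [CompleteSpace T.l2Graph]

theorem graphFst_comp_adjoint_nonneg :
    0 ≤ T.graphFst ∘L ContinuousLinearMap.adjoint T.graphFst :=
  (nonneg_iff_isPositive _).2 (isPositive_self_comp_adjoint _)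

theorem graphFst_comp_adjoint_le_one :
    T.graphFst ∘L ContinuousLinearMap.adjoint T.graphFst ≤ 1 := by
  refine sub_nonneg.1 <| (nonneg_iff_isPositive _).2 (isPositive_def'.2
    ⟨(IsSelfAdjoint.one _).sub (isPositive_self_comp_adjoint _).isSelfAdjoint, fun v => ?_⟩)
  have h1 : ‖ContinuousLinearMap.adjoint T.graphFst v‖ ≤ ‖v‖ := by
    refine (ContinuousLinearMap.le_opNorm _ v).trans (mul_le_of_le_one_left (norm_nonneg v) ?_)
    rw [LinearIsometryEquiv.norm_map]
    exact T.graphFst.opNorm_le_bound zero_le_one fun p => by simpa using T.norm_graphFst_le p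
  change 0 ≤ (⟪v - T.graphFst (ContinuousLinearMap.adjoint T.graphFst v), v⟫_ℂ).re
  rw [inner_sub_left, Complex.sub_re, ← adjoint_inner_right]
  have h2 : (⟪v, v⟫_ℂ).re = ‖v‖ ^ 2 := inner_self_eq_norm_sq (𝕜 := ℂ) v
  have h3 := inner_self_eq_norm_sq (𝕜 := ℂ) (ContinuousLinearMap.adjoint T.graphFst v)
  rw [RCLike.re_to_complex] at h3
  rw [h2, h3, sub_nonneg]
  gcongr

/-- This is the weak form of `T*T x = v - x` for `x = j j* v`, with `z = T x`. The next lemma is the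
converse. -/
theorem exists_mem_graph_adjoint_graphFst (v : X) : ∃ z,
    (T.graphFst (ContinuousLinearMap.adjoint T.graphFst v), z) ∈ T.graph ∧
      ∀ x y, (x, y) ∈ T.graph →
        ⟪z, y⟫_ℂ = ⟪v - T.graphFst (ContinuousLinearMap.adjoint T.graphFst v), x⟫_ℂ := by
  refine ⟨(ContinuousLinearMap.adjoint T.graphFst v : WithLp 2 (X × X₁)).snd,
    mem_l2Graph.1 (ContinuousLinearMap.adjoint T.graphFst v).2, fun x y hxy => ?_⟩
  have h := adjoint_inner_left T.graphFst ⟨WithLp.toLp 2 (x, y), hxy⟩ v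
  rw [Submodule.coe_inner, WithLp.prod_inner_apply] at h
  rw [inner_sub_left]
  exact eq_sub_of_add_eq' h

theorem graphFst_adjoint_eq {v x : X} {z : X₁} (hz : (x, z) ∈ T.graph)
    (h : ∀ a b, (a, b) ∈ T.graph → ⟪z, b⟫_ℂ = ⟪v - x, a⟫_ℂ) :
    T.graphFst (ContinuousLinearMap.adjoint T.graphFst v) = x := by
  have : ContinuousLinearMap.adjoint T.graphFst v = ⟨WithLp.toLp 2 (x, z), hz⟩ := by
    refine ext_inner_right ℂ fun p => ?_
    rw [adjoint_inner_left, Submodule.coe_inner, WithLp.prod_inner_apply]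
    have := h _ _ (mem_l2Graph.1 p.2)
    rw [inner_sub_left] at this
    exact (eq_add_of_sub_eq' this.symm).trans rfl
  rw [this]
  rfl

theorem graphFst_comp_adjoint_injective (hT : Dense (T.domain : Set X)) :
    Function.Injective (T.graphFst ∘L ContinuousLinearMap.adjoint T.graphFst) := by
  refine (injective_iff_map_eq_zero _).2 fun v hv => ?_
  obtain ⟨z, hz, h⟩ := T.exists_mem_graph_adjoint_graphFst v
  have hv' : T.graphFst (ContinuousLinearMap.adjoint T.graphFst v) = 0 := hv
  rw [hv'] at hz h
  have hz0 := graph_fst_eq_zero_snd T hz rfl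
  refine hT.eq_zero_of_inner_left ℂ fun a ha => ?_
  have := h a _ (T.mem_graph ⟨a, ha⟩)
  simpa [hz0] using this.symm

omit [CompleteSpace T.l2Graph] in
/-- For closed densely defined `T` the operator `H = T* T` is selfadjoint and nonnegative, and
`H^{1/2}` has the same domain as `T` and is metrically equal to it. -/
theorem exists_isSelfAdjoint_posSqrt [CompleteSpace X₁] (hT : T.IsClosed) (hd : Dense (T.domain : Set X)) :
    ∃ H : X →ₗ.[ℂ] X, IsSelfAdjoint H ∧ H.posSqrt.IsPosSqrt H ∧
      (∀ x y, (x, y) ∈ H.graph → ∃ z, (x, z) ∈ T.graph ∧ ⟪y, x⟫_ℂ = ⟪z, z⟫_ℂ) ∧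
      (∀ x z, (x, z) ∈ T.graph → ∃ z', (x, z') ∈ H.posSqrt.graph ∧ ‖z'‖ = ‖z‖) ∧
      ∀ x z', (x, z') ∈ H.posSqrt.graph → ∃ z, (x, z) ∈ T.graph ∧ ‖z‖ = ‖z'‖ := by
  have : CompleteSpace T.l2Graph := hT.isClosed_l2Graph.completeSpace_coe
  have hR0 := T.graphFst_comp_adjoint_nonneg
  obtain ⟨H, hH, hHg⟩ := exists_isSelfAdjoint_of_resolvent
    (IsSelfAdjoint.of_nonneg hR0) (T.graphFst_comp_adjoint_injective hd)
  have hS := isPosSqrt_posSqrt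
    (exists_isPosSqrt_of_resolvent hR0 T.graphFst_comp_adjoint_le_one hHg)
  have : CompleteSpace H.posSqrt.l2Graph :=
    hS.isSelfAdjoint.isClosed.isClosed_l2Graph.completeSpace_coe
  -- For selfadjoint `H^{1/2}`, `(1 + (H^{1/2})* H^{1/2})⁻¹ = (1 + H)⁻¹`, which is the resolvent
  -- that defined `H`.
  have hRR : T.graphFst ∘L ContinuousLinearMap.adjoint T.graphFst =
      H.posSqrt.graphFst ∘L ContinuousLinearMap.adjoint H.posSqrt.graphFst := by
    ext v
    obtain ⟨z, h1, h2⟩ := (hS.sq (T.graphFst (ContinuousLinearMap.adjoint T.graphFst v))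
      (v - T.graphFst (ContinuousLinearMap.adjoint T.graphFst v))).1
        ((hHg _ _).2 (by rw [add_sub_cancel]; rfl))
    refine (H.posSqrt.graphFst_adjoint_eq h1 fun a b hab => ?_).symm
    exact ((mem_graph_iff_of_isSelfAdjoint hS.isSelfAdjoint).1 hab _ _ h2).symm
  refine ⟨H, hH, hS, fun x y hxy => ?_, fun x z h => exists_mem_graph_of_resolvent_eq hRR h,
    fun x z h => exists_mem_graph_of_resolvent_eq hRR.symm h⟩
  have hx : T.graphFst (ContinuousLinearMap.adjoint T.graphFst (x + y)) = x := (hHg x y).1 hxy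
  obtain ⟨z, hz, h⟩ := T.exists_mem_graph_adjoint_graphFst (x + y)
  rw [hx] at hz h
  exact ⟨z, hz, by rw [h x z hz, add_sub_cancel_left]⟩

end Resolvent
end LinearPMap

/-! ### Block operators and their quadratic forms. -/

section BlockOp

variable {X U X' Y : Type*}
  [NormedAddCommGroup X] [InnerProductSpace ℂ X]
  [NormedAddCommGroup U] [InnerProductSpace ℂ U]
  [NormedAddCommGroup X'] [InnerProductSpace ℂ X']
  [NormedAddCommGroup Y] [InnerProductSpace ℂ Y]

theorem blockOp_apply (A : X →L[ℂ] X') (B : U →L[ℂ] X') (C : X →L[ℂ] Y) (D : U →L[ℂ] Y)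
    (p : WithLp 2 (X × U)) :
    blockOp A B C D p = WithLp.toLp 2 (A p.fst + B p.snd, C p.fst + D p.snd) := rfl

omit [InnerProductSpace ℂ X] [InnerProductSpace ℂ U] in
theorem norm_toLp_sq (x : X) (u : U) : ‖WithLp.toLp 2 (x, u)‖ ^ 2 = ‖x‖ ^ 2 + ‖u‖ ^ 2 :=
  WithLp.prod_norm_sq_eq_of_L2 _

theorem inner_blockOp_adjoint_comp_self [CompleteSpace X] (G : X →L[ℂ] X') [CompleteSpace X']
    (p : WithLp 2 (X × U)) :
    ⟪blockOp (ContinuousLinearMap.adjoint G ∘L G) 0 0 (ContinuousLinearMap.id ℂ U) p, p⟫_ℂ =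
      ((‖G p.fst‖ ^ 2 + ‖p.snd‖ ^ 2 : ℝ) : ℂ) := by
  rw [blockOp_apply, WithLp.prod_inner_apply]
  simp [ContinuousLinearMap.adjoint_inner_left, inner_self_eq_norm_sq_to_K]

end BlockOp

/-! ### Similarity and bounded solutions. -/

namespace DTSystem

variable {X X' U Y : Type*}
  [NormedAddCommGroup X] [InnerProductSpace ℂ X]
  [NormedAddCommGroup X'] [InnerProductSpace ℂ X']
  [NormedAddCommGroup U] [InnerProductSpace ℂ U]
  [NormedAddCommGroup Y] [InnerProductSpace ℂ Y]

theorem isContractive_iff [CompleteSpace X] [CompleteSpace U] [CompleteSpace Y]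
    (S : DTSystem X U Y) : S.IsContractive ↔ ∀ x u,
      ‖S.A x + S.B u‖ ^ 2 + ‖S.C x + S.D u‖ ^ 2 ≤ ‖x‖ ^ 2 + ‖u‖ ^ 2 := by
  rw [IsContractive, ContinuousLinearMap.opNorm_le_iff zero_le_one]
  constructor
  · intro h x u
    have := h (WithLp.toLp 2 (x, u))
    rw [one_mul, ← sq_le_sq₀ (norm_nonneg _) (norm_nonneg _), norm_toLp_sq x u] at this
    exact (norm_toLp_sq _ _).symm.le.trans this
  · intro h p
    rw [one_mul, ← sq_le_sq₀ (norm_nonneg _) (norm_nonneg _), WithLp.prod_norm_sq_eq_of_L2 p]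
    exact (norm_toLp_sq _ _).le.trans (h p.fst p.snd)

variable [CompleteSpace X] [CompleteSpace X'] [CompleteSpace U] [CompleteSpace Y]

theorem kypInequality_adjoint_comp_self_iff (S : DTSystem X U Y) (G : X →L[ℂ] X') :
    S.KYPInequality (ContinuousLinearMap.adjoint G ∘L G) ↔ ∀ x u,
      ‖G (S.A x + S.B u)‖ ^ 2 + ‖S.C x + S.D u‖ ^ 2 ≤ ‖G x‖ ^ 2 + ‖u‖ ^ 2 := by
  have key (p : WithLp 2 (X × U)) :
      ⟪(blockOp (ContinuousLinearMap.adjoint G ∘L G) 0 0 (ContinuousLinearMap.id ℂ U) -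
        ContinuousLinearMap.adjoint S.systemMatrix ∘L
          blockOp (ContinuousLinearMap.adjoint G ∘L G) 0 0 (ContinuousLinearMap.id ℂ Y) ∘L
            S.systemMatrix) p, p⟫_ℂ =
      ((‖G p.fst‖ ^ 2 + ‖p.snd‖ ^ 2 - (‖G (S.A p.fst + S.B p.snd)‖ ^ 2 +
        ‖S.C p.fst + S.D p.snd‖ ^ 2) : ℝ) : ℂ) := by
    rw [sub_apply, inner_sub_left, inner_blockOp_adjoint_comp_self,
      ContinuousLinearMap.comp_apply, ContinuousLinearMap.adjoint_inner_left,
      ContinuousLinearMap.comp_apply, inner_blockOp_adjoint_comp_self, Complex.ofReal_sub]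
    rfl
  rw [KYPInequality, ContinuousLinearMap.le_def, ContinuousLinearMap.isPositive_iff_complex]
  simp only [key, RCLike.re_to_complex, Complex.ofReal_re, true_and, sub_nonneg]
  exact ⟨fun h x u => h (WithLp.toLp 2 (x, u)), fun h p => h p.fst p.snd⟩

theorem Similar.exists_kyp {S : DTSystem X U Y} {S' : DTSystem X' U Y} (h : S.Similar S')
    (hc : S'.IsContractive) : ∃ H : X →L[ℂ] X, IsStrictlyPosDef H ∧ S.KYPInequality H := by
  obtain ⟨Γ, hA, hB, hC, hD⟩ := h
  let G : X →L[ℂ] X' := Γ.toContinuousLinearMap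
  refine ⟨ContinuousLinearMap.adjoint G ∘L G,
    ⟨(ContinuousLinearMap.isPositive_adjoint_comp_self G).isSelfAdjoint, ?_⟩, ?_⟩
  -- The summand 1 keeps `c` positive even on the zero space; `‖x‖ ≤ c ‖Γx‖` then gives `δ = c⁻²`.
  · set c := ‖(Γ.symm : X' →L[ℂ] X)‖ + 1
    have hc0 : 0 < c := by positivity
    refine ⟨(c ^ 2)⁻¹, by positivity, fun x => ?_⟩
    rw [ContinuousLinearMap.comp_apply, ContinuousLinearMap.adjoint_inner_left]
    have h1 := inner_self_eq_norm_sq (𝕜 := ℂ) (G x)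
    rw [RCLike.re_to_complex] at h1
    rw [h1, inv_mul_le_iff₀ (by positivity), ← mul_pow]
    have h2 : ‖x‖ ≤ ‖(Γ.symm : X' →L[ℂ] X)‖ * ‖Γ x‖ := by
      simpa using (Γ.symm : X' →L[ℂ] X).le_opNorm (Γ x)
    have h3 : ‖x‖ ≤ c * ‖G x‖ :=
      h2.trans (mul_le_mul_of_nonneg_right (by simp [c]) (norm_nonneg _))
    exact pow_le_pow_left₀ (norm_nonneg x) h3 2
  · rw [kypInequality_adjoint_comp_self_iff]
    intro x u
    have := S'.isContractive_iff.1 hc (Γ x) u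
    rw [hA, hB, hC, hD] at this
    simpa [G] using this

theorem exists_similar_of_kyp {S : DTSystem X U Y} {H : X →L[ℂ] X} (hH : IsStrictlyPosDef H)
    (hk : S.KYPInequality H) : ∃ S' : DTSystem X U Y, S.Similar S' ∧ S'.IsContractive := by
  obtain ⟨hsa, δ, hδ, hb⟩ := hH
  have hH0 : 0 ≤ H := (ContinuousLinearMap.nonneg_iff_isPositive _).2
    (ContinuousLinearMap.isPositive_def'.2 ⟨hsa, fun x => le_trans (by positivity) (hb x)⟩)
  -- Strict positivity makes `H`, and so its square root, boundedly invertible; the square root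
  -- serves as `Γ`.
  have hu : IsUnit H := by
    refine ContinuousLinearMap.isUnit_of_forall_le_norm_inner_map H (c := ⟨δ, hδ.le⟩) hδ ?_
    intro x
    refine le_trans (le_of_eq ?_) ((hb x).trans (Complex.re_le_norm _))
    exact mul_comm _ _
  have hGG : CFC.sqrt H * CFC.sqrt H = H := CFC.sqrt_mul_sqrt_self H hH0
  have hGu : IsUnit (CFC.sqrt H) := (CFC.isUnit_sqrt_iff H hH0).2 hu
  have hGs : ContinuousLinearMap.adjoint (CFC.sqrt H) = CFC.sqrt H :=
    (IsSelfAdjoint.of_nonneg (CFC.sqrt_nonneg H)).adjoint_eq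
  obtain ⟨g, hg⟩ := hGu
  let Γ : X ≃L[ℂ] X := ContinuousLinearEquiv.unitsEquiv ℂ X g
  have hΓ : (Γ : X →L[ℂ] X) = CFC.sqrt H := hg
  have hk' : S.KYPInequality
      (ContinuousLinearMap.adjoint (Γ : X →L[ℂ] X) ∘L (Γ : X →L[ℂ] X)) := by
    rw [hΓ, hGs]
    change S.KYPInequality (CFC.sqrt H * CFC.sqrt H)
    rwa [hGG]
  rw [kypInequality_adjoint_comp_self_iff] at hk'
  refine ⟨⟨Γ.toContinuousLinearMap ∘L S.A ∘L Γ.symm.toContinuousLinearMap,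
    Γ.toContinuousLinearMap ∘L S.B, S.C ∘L Γ.symm.toContinuousLinearMap, S.D⟩,
    ⟨Γ, rfl, rfl, rfl, rfl⟩, (isContractive_iff _).2 fun x u => ?_⟩
  simpa using hk' (Γ.symm x) u

/-! ### Pseudo-similarity and unbounded solutions. -/

theorem PseudoSimilar.exists_generalizedKYP {S : DTSystem X U Y} {S' : DTSystem X' U Y}
    (h : S.PseudoSimilar S') (hc : S'.IsContractive) :
    ∃ H : X →ₗ.[ℂ] X, S.IsGeneralizedKYPSolution H := by
  obtain ⟨hD, Γ, hΓ⟩ := h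
  obtain ⟨H, hH, -, hform, hto, hfrom⟩ :=
    Γ.exists_isSelfAdjoint_posSqrt hΓ.isClosed hΓ.dense_domain
  have hmem (x : X) : x ∈ H.posSqrt.domain ↔ x ∈ Γ.domain := by
    rw [LinearPMap.mem_domain_iff, LinearPMap.mem_domain_iff]
    exact ⟨fun ⟨z, hz⟩ => (hfrom x z hz).imp fun _ h => h.1,
      fun ⟨z, hz⟩ => (hto x z hz).imp fun _ h => h.1⟩
  have hnorm (x : H.posSqrt.domain) : ‖H.posSqrt x‖ = ‖Γ ⟨x, (hmem x).1 x.2⟩‖ := by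
    obtain ⟨z, hz, hzn⟩ := hfrom x _ (H.posSqrt.mem_graph x)
    rw [← hzn, LinearPMap.mem_graph_snd_inj Γ hz (Γ.mem_graph ⟨x, (hmem x).1 x.2⟩) rfl]
  -- Since `⟪Hx, x⟫ = ‖Γx‖²`, injectivity of `Γ` yields both injectivity and positivity of `H`.
  have hzero {x y : X} (hxy : (x, y) ∈ H.graph) (h0 : (⟪y, x⟫_ℂ).re ≤ 0) : x = 0 := by
    obtain ⟨z, hz, hyz⟩ := hform x y hxy
    rw [hyz] at h0
    have hz0 : z = 0 := by
      have h1 := inner_self_eq_norm_sq (𝕜 := ℂ) z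
      rw [RCLike.re_to_complex] at h1
      rw [h1] at h0
      exact norm_eq_zero.1 (pow_eq_zero_iff two_ne_zero |>.1 (le_antisymm h0 (sq_nonneg _)))
    obtain ⟨t, rfl, ht⟩ := (LinearPMap.mem_graph_iff Γ).1 hz
    have : t = 0 := hΓ.injective (by rw [LinearPMap.map_zero]; exact ht.trans hz0)
    simp [this]
  refine ⟨H, ⟨hH.isClosed, hH.dense_domain, ?_, hH, ?_, ?_, ?_, ?_⟩⟩
  · intro x y hxy
    have h0 : H (x - y) = 0 := by rw [LinearPMap.map_sub]; exact sub_eq_zero.2 hxy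
    have := hzero (H.mem_graph (x - y)) (by simp [h0])
    exact sub_eq_zero.1 (Subtype.ext this)
  · intro x hx
    by_contra hle
    exact hx (Subtype.ext (hzero (H.mem_graph x) (not_lt.1 hle)))
  · exact fun x hx => (hmem _).2 (hΓ.mapsTo_A x ((hmem x).1 hx))
  · exact fun u => (hmem _).2 (hΓ.mapsTo_B u)
  · intro x u
    rw [norm_toLp_sq, norm_toLp_sq, hnorm, hnorm, sub_nonneg]
    have hx := (hmem x).1 x.2
    have e1 : Γ ⟨S.A x + S.B u, Γ.domain.add_mem (hΓ.mapsTo_A x hx) (hΓ.mapsTo_B u)⟩ =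
        S'.A (Γ ⟨x, hx⟩) + S'.B u := by
      rw [← hΓ.intertwine_A ⟨x, hx⟩, hΓ.intertwine_B, ← LinearPMap.map_add]
      rfl
    have e2 : S.C x = S'.C (Γ ⟨x, hx⟩) := hΓ.intertwine_C ⟨x, hx⟩
    rw [e1, e2, hD]
    exact S'.isContractive_iff.1 hc _ u

theorem IsGeneralizedKYPSolution.exists_pseudoSimilar {S : DTSystem X U Y} {H : X →ₗ.[ℂ] X}
    (hk : S.IsGeneralizedKYPSolution H) :
    ∃ S' : DTSystem X U Y, S.PseudoSimilar S' ∧ S'.IsContractive := by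
  have hpos (x : H.domain) : 0 ≤ (⟪H x, (x : X)⟫_ℂ).re := by
    by_cases hx : x = 0
    · simp [hx]
    · exact (hk.pos x hx).le
  obtain ⟨R, hR0, hR1, hR⟩ := LinearPMap.exists_resolvent_of_isSelfAdjoint hk.isSelfAdjoint hpos
  have hsq := LinearPMap.isPosSqrt_posSqrt (LinearPMap.exists_isPosSqrt_of_resolvent hR0 hR1 hR)
  have hA := hk.mapsTo_A
  have hB := hk.mapsTo_B
  have hsp := hk.spatial
  set Q := H.posSqrt
  have hQ0 {x : X} (hx : (x, (0 : X)) ∈ Q.graph) : x = 0 := by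
    obtain ⟨t, rfl, ht⟩ := (LinearPMap.mem_graph_iff H).1 ((hsq.sq x 0).2 ⟨0, hx, Q.graph.zero_mem⟩)
    have : t = 0 := hk.injective (ht.trans (LinearPMap.map_zero H).symm)
    simp [this]
  have hrange : DenseRange Q := by
    -- For a selfadjoint operator the orthogonal complement of the range is the kernel, which is
    -- trivial here.
    have horth : (LinearMap.range Q.toFun)ᗮ = ⊥ := by
      refine (Submodule.eq_bot_iff _).2 fun w hw => hQ0 ?_
      refine (LinearPMap.mem_graph_iff_of_isSelfAdjoint hsq.isSelfAdjoint).2 fun a b hab => ?_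
      obtain ⟨t, rfl, rfl⟩ := (LinearPMap.mem_graph_iff Q).1 hab
      rw [inner_zero_right]
      exact (Submodule.mem_orthogonal _ _).1 hw _ ⟨t, rfl⟩
    have h := (Submodule.dense_iff_topologicalClosure_eq_top).2
      ((Submodule.topologicalClosure_eq_top_iff).2 horth)
    rw [LinearMap.coe_range] at h
    exact h
  let A₀ : Q.domain →ₗ[ℂ] Q.domain := (S.A : X →ₗ[ℂ] X).restrict hA
  let B₀ : U →ₗ[ℂ] Q.domain := (S.B : U →ₗ[ℂ] X).codRestrict _ hB
  -- The spatial inequality is `‖f p‖ ≤ ‖e p‖` with `e(x, u) = (Qx, u)` and `f(x, u) = (Q(Ax + Bu),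
  -- Cx + Du)`; `e` has dense range, so `e p ↦ f p` extends to a contraction `M`.
  let e : Q.domain × U →ₗ[ℂ] WithLp 2 (X × U) :=
    (WithLp.linearEquiv 2 ℂ (X × U)).symm.toLinearMap ∘ₗ Q.toFun.prodMap LinearMap.id
  let f : Q.domain × U →ₗ[ℂ] WithLp 2 (X × Y) :=
    (WithLp.linearEquiv 2 ℂ (X × Y)).symm.toLinearMap ∘ₗ
      (Q.toFun ∘ₗ A₀.coprod B₀).prod
        (((S.C : X →ₗ[ℂ] Y) ∘ₗ Q.domain.subtype).coprod (S.D : U →ₗ[ℂ] Y))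
  have he : DenseRange e := by
    have h1 : DenseRange (Prod.map Q (id : U → U)) := hrange.prodMap Function.surjective_id.denseRange
    exact (WithLp.prodContinuousLinearEquiv 2 ℂ X U).symm.surjective.denseRange.comp h1
      (WithLp.prodContinuousLinearEquiv 2 ℂ X U).symm.continuous
  have hfe (p : Q.domain × U) : ‖f p‖ ≤ 1 * ‖e p‖ := by
    rw [one_mul, ← sq_le_sq₀ (norm_nonneg _) (norm_nonneg _)]
    exact sub_nonneg.1 (hsp p.1 p.2)
  let M : WithLp 2 (X × U) →L[ℂ] WithLp 2 (X × Y) := f.extendOfNorm e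
  have hM (x : Q.domain) (u : U) : M (WithLp.toLp 2 (Q x, u)) =
      WithLp.toLp 2 (Q (A₀ x + B₀ u), S.C x + S.D u) := by
    have := LinearMap.extendOfNorm_eq he ⟨1, hfe⟩ (x, u)
    exact this.trans (by simp [f])
  have hMn (p : WithLp 2 (X × U)) : ‖M p‖ ≤ ‖p‖ := by
    simpa using LinearMap.norm_extendOfNorm_apply_le he 1 hfe p
  let fst' : WithLp 2 (X × Y) →L[ℂ] X := ContinuousLinearMap.fst ℂ X Y ∘L
    (WithLp.prodContinuousLinearEquiv 2 ℂ X Y).toContinuousLinearMap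
  let snd' : WithLp 2 (X × Y) →L[ℂ] Y := ContinuousLinearMap.snd ℂ X Y ∘L
    (WithLp.prodContinuousLinearEquiv 2 ℂ X Y).toContinuousLinearMap
  let inl' : X →L[ℂ] WithLp 2 (X × U) :=
    (WithLp.prodContinuousLinearEquiv 2 ℂ X U).symm.toContinuousLinearMap ∘L
      ContinuousLinearMap.inl ℂ X U
  let inr' : U →L[ℂ] WithLp 2 (X × U) :=
    (WithLp.prodContinuousLinearEquiv 2 ℂ X U).symm.toContinuousLinearMap ∘L
      ContinuousLinearMap.inr ℂ X U
  have hMl (x : Q.domain) : M (inl' (Q x)) = WithLp.toLp 2 (Q (A₀ x), S.C x) := by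
    have h := hM x 0
    rw [map_zero, add_zero, map_zero, add_zero] at h
    exact h
  have hMr (u : U) : M (inr' u) = WithLp.toLp 2 (Q (B₀ u), S.D u) := by
    have h := hM 0 u
    rw [map_zero, zero_add, LinearPMap.map_zero, ZeroMemClass.coe_zero, map_zero, zero_add] at h
    exact h
  let S' : DTSystem X U Y := ⟨fst' ∘L M ∘L inl', fst' ∘L M ∘L inr', snd' ∘L M ∘L inl', S.D⟩
  have hMS (x : X) (u : U) : M (WithLp.toLp 2 (x, u)) =
      WithLp.toLp 2 (S'.A x + S'.B u, S'.C x + S'.D u) := by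
    have h1 : WithLp.toLp 2 (x, u) = inl' x + inr' u := by
      rw [← ContinuousLinearEquiv.symm_apply_apply (WithLp.prodContinuousLinearEquiv 2 ℂ X U)
        (inl' x + inr' u)]
      simp [inl', inr']
    -- The lower right corner of `M` is already `D`, so `M` is the system matrix of `S'`.
    have h2 : S.D u = (M (inr' u)).snd := by rw [hMr]; rfl
    have h3 : S'.D u = (M (inr' u)).snd := h2
    rw [h1, map_add, h3]
    rfl
  refine ⟨S', ⟨rfl, Q, ?_⟩, (isContractive_iff _).2 fun x u => ?_⟩
  · refine ⟨fun x y hxy => ?_, hsq.isSelfAdjoint.isClosed, hsq.isSelfAdjoint.dense_domain, hrange,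
      hA, fun x => ?_, hB, fun u => ?_, fun x => ?_⟩
    · have h0 : Q (x - y) = 0 := by rw [LinearPMap.map_sub]; exact sub_eq_zero.2 hxy
      have h1 := Q.mem_graph (x - y)
      rw [h0] at h1
      exact sub_eq_zero.1 (Subtype.ext (hQ0 h1))
    · exact (congrArg (fun p : WithLp 2 (X × Y) => p.fst) (hMl x)).symm
    · exact congrArg (fun p : WithLp 2 (X × Y) => p.fst) (hMr u)
    · exact (congrArg (fun p : WithLp 2 (X × Y) => p.snd) (hMl x)).symm
  · have := pow_le_pow_left₀ (norm_nonneg _) (hMn (WithLp.toLp 2 (x, u))) 2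
    rwa [hMS, norm_toLp_sq, norm_toLp_sq] at this

end DTSystem

theorem lemma4p1 {X : Type u} {U : Type v} {Y : Type w}
    [NormedAddCommGroup X] [InnerProductSpace ℂ X] [CompleteSpace X]
    [NormedAddCommGroup U] [InnerProductSpace ℂ U] [CompleteSpace U]
    [NormedAddCommGroup Y] [InnerProductSpace ℂ Y] [CompleteSpace Y]
    (S : DTSystem X U Y) :
    ((∃ (X' : Type u) (_ : NormedAddCommGroup X') (_ : InnerProductSpace ℂ X')
          (_ : CompleteSpace X') (S' : DTSystem X' U Y),
          S.Similar S' ∧ S'.IsContractive) ↔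
      ∃ H : X →L[ℂ] X, DTSystem.IsStrictlyPosDef H ∧ S.KYPInequality H) ∧
    ((∃ (X' : Type u) (_ : NormedAddCommGroup X') (_ : InnerProductSpace ℂ X')
          (_ : CompleteSpace X') (S' : DTSystem X' U Y),
          S.PseudoSimilar S' ∧ S'.IsContractive) ↔
      ∃ H : X →ₗ.[ℂ] X, S.IsGeneralizedKYPSolution H) := by
  refine ⟨⟨?_, ?_⟩, ?_, ?_⟩
  · rintro ⟨X', _, _, _, S', h, hc⟩
    exact h.exists_kyp hc
  · rintro ⟨H, hH, hk⟩
    exact ⟨X, _, _, ‹_›, DTSystem.exists_similar_of_kyp hH hk⟩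
  · rintro ⟨X', _, _, _, S', h, hc⟩
    exact h.exists_generalizedKYP hc
  · rintro ⟨H, hk⟩
    exact ⟨X, _, _, ‹_›, hk.exists_pseudoSimilar⟩
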